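/- Theorem 5. Fix integers $0\le a_1<a_2<a_3<a_4$ and $N\ge 1$. An $\{a_1,a_2,a_3,a_4\}$-sum with $N$ summands is the distribution of $X_1+\dots+X_N$, where $X_1,\dots,X_N$ are independent (not necessarily identically distributed) integer random variables whose supports have union $\{a_1,a_2,a_3,a_4\}$. For $m\ge 0$ and $\varepsilon>0$, an $m$-sample algorithm learns these sums to accuracy $\varepsilon$ if, for every $\{a_1,\dots,a_4\}$-sum $S$ with $N$ summands, when given $m$ i.i.d. draws from $S$ (and possibly using internal randomness) it outputs, with probability at least $9/10$, a hypothesis distribution $\tilde S$ on $\mathbb{Z}$ with $d_{\mathrm{TV}}(\tilde S,S)\le\varepsilon$, where $d_{\mathrm{TV}}(P,P')=\frac12\sum_{z\in\mathbb{Z}}|P(z)-P'(z)|$. The algorithm may depend on $N$, $\varepsilon$ and $a_1,\dots,a_4$. There are absolute constants $\varepsilon_0>0$ and $c>0$ and infinitely many quadruples of integers $0\le a_1<a_2<a_3<a_4$ such that, for all sufficiently large $N$ (depending on the quadruple) and every $0<\varepsilon\le\varepsilon_0$, every $m$-sample algorithm that learns $\{a_1,a_2,a_3,a_4\}$-sums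 with $N$ summands to accuracy $\varepsilon$ satisfies $m\ge c\,\log\log a_4$. -/

import Mathlib

open MeasureTheory ProbabilityTheory

/-- Total variation distance `(1/2) ∑_z |P(z) - Q(z)|` of two probability distributions on `ℤ`. -/
noncomputable def tvDist (P Q : ProbabilityMeasure ℤ) : ℝ :=
  (1 / 2) * ∑' z : ℤ, |(P : Measure ℤ).real {z} - (Q : Measure ℤ).real {z}|

/-- The support `{z | P(z) ≠ 0}` of a probability distribution on `ℤ`. -/
def distSupport (P : ProbabilityMeasure ℤ) : Set ℤ :=
  {z | (P : Measure ℤ) {z} ≠ 0}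

/-- `S` is (the law of) an `A`-sum with `N` summands: `S` is the law of `X_1 + ⋯ + X_N` for
independent integer random variables `X_1, …, X_N` (with laws `ν 1, …, ν N`, not necessarily
equal) whose supports have union `A`. -/
def IsSupportSum (A : Set ℤ) (N : ℕ) (S : ProbabilityMeasure ℤ) : Prop :=
  ∃ ν : Fin N → ProbabilityMeasure ℤ,
    (⋃ i, distSupport (ν i)) = A ∧
    (S : Measure ℤ) =
      (Measure.pi fun i => (ν i : Measure ℤ)).map (fun x : Fin N → ℤ => ∑ i, x i)

/-- A (possibly randomized) learning algorithm that draws `m` samples: on the sample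
`x : Fin m → ℤ` it outputs a random hypothesis distribution on `ℤ`, with law `hyp x`. -/
structure Learner (m : ℕ) where
  /-- the law of the hypothesis, given the sample -/
  hyp : Kernel (Fin m → ℤ) (ProbabilityMeasure ℤ)
  /-- for each sample, this is a probability measure on hypotheses -/
  isMarkov : IsMarkovKernel hyp

/-- The law of the hypothesis that the learner outputs when its `m` samples are
i.i.d. draws from `S`. -/
noncomputable def Learner.outputLaw {m : ℕ} (L : Learner m) (S : ProbabilityMeasure ℤ) :
    Measure (ProbabilityMeasure ℤ) :=
  (Measure.pi fun _ : Fin m => (S : Measure ℤ)).bind L.hyp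

/-- The learner learns `A`-sums with `N` summands to accuracy `ε`: for each such target `S`, with
probability at least `9/10` its hypothesis is within total variation distance `ε` of `S`. -/
def Learner.LearnsSums {m : ℕ} (L : Learner m) (A : Set ℤ) (N : ℕ) (ε : ℝ) : Prop :=
  ∀ S : ProbabilityMeasure ℤ, IsSupportSum A N S →
    9 / 10 ≤ L.outputLaw S {H : ProbabilityMeasure ℤ | tvDist H S ≤ ε}

/-! Let `M = fib (8 * (T + 1))` and `v = fib (8 * (T + 1) - 1)`. Each splitting `j + l = 8 * (T +
1)` into positive multiples of 8 gives a sum supported on `{0, 1, v, M}`. These `T` sums are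
pairwise far apart, yet all lie below one weight of mass at most `2 * latticeMass`. Success events
for separated targets are disjoint, so adding the success probabilities gives `T * (9 / 10) ≤ (2 *
latticeMass) ^ m` (`Learner.card_le_pow`). Since `T` is of order `log M`, this forces `m` to be at
least of order `log log M`.

The sum at level `j` has `fib l ^ 2` fair steps of length `1`, `fib j ^ 2` of length `v`, and many
of length `M`. Its Fourier coefficient at `ξ` modulo `M` decays like a Gaussian in `ξ * fib l / M`
and `η * fib j / M`, where `η` is the least residue of `v * ξ`. The pairs `(ξ, η)` lie in a lattice
of covolume `M`, and by Cassini's identity it has a basis fitted to the box `fib j × fib l`,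
whatever `j` is. Hence the Fourier mass is bounded uniformly in `j`, and every residue has
probability at most `latticeMass / M` (`fibLaw_residue_le`). The steps of length `M` then blur the
quotient by `M` into one binomial envelope common to all levels (`addFairSteps_real_singleton_le`).

For separation, `(fib j, ± fib l)` is a lattice vector, so the character of frequency `fib j` has a
coefficient bounded below at level `j`; at lower levels the more numerous unit steps make it tiny.
Steps of length `M` do not affect characters modulo `M`. -/

/-! ### Total variation distance and packing -/

theorem ProbabilityMeasure.measurable_apply_singleton (z : ℤ) :
    Measurable fun H : ProbabilityMeasure ℤ => (H : Measure ℤ).real {z} := by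
  have h : Measurable fun H : ProbabilityMeasure ℤ => (H : Measure ℤ) {z} :=
    (Measure.measurable_coe (measurableSet_singleton z)).comp measurable_subtype_coe
  exact h.ennreal_toReal

theorem measurableSet_tvDist_le (S : ProbabilityMeasure ℤ) (ε : ℝ) :
    MeasurableSet {H : ProbabilityMeasure ℤ | tvDist H S ≤ ε} := by
  refine measurableSet_le (Measurable.const_mul (Measurable.tsum fun z => ?_) _) measurable_const
  have := ProbabilityMeasure.measurable_apply_singleton z
  exact (this.sub_const _).abs

theorem hasSum_real_singleton (P : ProbabilityMeasure ℤ) :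
    HasSum (fun z : ℤ => (P : Measure ℤ).real {z}) 1 := by
  have h : ∑' z : ℤ, (P : Measure ℤ) {z} = 1 := by
    have := lintegral_countable' (μ := (P : Measure ℤ)) (fun _ => 1)
    simpa using this.symm
  have hs := ENNReal.hasSum_toReal (f := fun z : ℤ => (P : Measure ℤ) {z}) (by simp [h])
  rw [← ENNReal.tsum_toReal_eq (fun z => by simp), h] at hs
  exact hs

theorem summable_abs_sub_real_singleton (P Q : ProbabilityMeasure ℤ) :
    Summable fun z : ℤ => |(P : Measure ℤ).real {z} - (Q : Measure ℤ).real {z}| :=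
  ((hasSum_real_singleton P).summable.sub (hasSum_real_singleton Q).summable).abs

/-- Bounded test functions detect total variation distance. -/
theorem norm_integral_sub_le_tvDist (P Q : ProbabilityMeasure ℤ) (f : ℤ → ℂ)
    (hf : ∀ z, ‖f z‖ ≤ 1) :
    ‖(∫ z, f z ∂(P : Measure ℤ)) - ∫ z, f z ∂(Q : Measure ℤ)‖ ≤ 2 * tvDist P Q := by
  have hi (P : ProbabilityMeasure ℤ) : Integrable f (P : Measure ℤ) :=
    Integrable.of_bound (by fun_prop) 1 (Filter.Eventually.of_forall hf)
  have hsm (P : ProbabilityMeasure ℤ) :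
      Summable fun z : ℤ => (P : Measure ℤ).real {z} • f z := by
    refine Summable.of_norm_bounded (hasSum_real_singleton P).summable fun z => ?_
    rw [norm_smul, Real.norm_of_nonneg measureReal_nonneg]
    exact mul_le_of_le_one_right measureReal_nonneg (hf z)
  rw [integral_countable (hi P), integral_countable (hi Q), ← (hsm P).tsum_sub (hsm Q)]
  unfold tvDist
  rw [← mul_assoc]
  norm_num
  refine tsum_of_norm_bounded (summable_abs_sub_real_singleton P Q).hasSum fun z => ?_
  rw [← Complex.real_smul, ← Complex.real_smul, ← sub_smul, norm_smul, Real.norm_eq_abs]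
  exact mul_le_of_le_one_right (abs_nonneg _) (hf z)

theorem tvDist_triangle_right (H P Q : ProbabilityMeasure ℤ) :
    tvDist P Q ≤ tvDist H P + tvDist H Q := by
  unfold tvDist
  rw [← mul_add, ← (summable_abs_sub_real_singleton H P).tsum_add
    (summable_abs_sub_real_singleton H Q)]
  refine mul_le_mul_of_nonneg_left ?_ (by norm_num)
  refine (summable_abs_sub_real_singleton P Q).tsum_le_tsum (fun z => ?_)
    ((summable_abs_sub_real_singleton H P).add (summable_abs_sub_real_singleton H Q))
  rw [abs_sub_comm ((H : Measure ℤ).real {z})]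
  exact abs_sub_le _ _ _

/-- A packing bound: well separated targets that are all dominated by one finite weight cannot be
told apart from few samples. -/
theorem Learner.card_le_pow {m : ℕ} (L : Learner m) {ι : Type*} [Fintype ι]
    (S : ι → ProbabilityMeasure ℤ) (ε : ℝ) (g : ℤ → ENNReal) (C : ENNReal)
    (hC : C ≠ ⊤) (hg : ∑' z, g z ≤ C) (hS : ∀ i z, (S i : Measure ℤ) {z} ≤ g z)
    (hsep : ∀ i j, i ≠ j → 2 * ε < tvDist (S i) (S j))
    (hL : ∀ i, 9 / 10 ≤ L.outputLaw (S i) {H : ProbabilityMeasure ℤ | tvDist H (S i) ≤ ε}) :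
    (Fintype.card ι : ENNReal) * (9 / 10) ≤ C ^ m := by
  have := L.isMarkov
  set E : ι → Set (ProbabilityMeasure ℤ) := fun i => {H | tvDist H (S i) ≤ ε} with hE
  have hEm (i) : MeasurableSet (E i) := measurableSet_tvDist_le _ _
  have hdisj : Pairwise (Function.onFun Disjoint E) := fun i j hij => by
    refine Set.disjoint_left.2 fun H hi hj => ?_
    have h1 := tvDist_triangle_right H (S i) (S j)
    have h2 := hsep i j hij
    simp only [hE, Set.mem_ofPred_eq] at hi hj
    linarith
  have hlaw (i : ι) : L.outputLaw (S i) (E i) ≤ ∑' x : Fin m → ℤ, (∏ k, g (x k)) * L.hyp x (E i) := by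
    unfold Learner.outputLaw
    rw [Measure.bind_apply (hEm i) L.hyp.measurable.aemeasurable, lintegral_countable']
    refine ENNReal.tsum_le_tsum fun x => ?_
    rw [mul_comm, Measure.pi_singleton]
    gcongr with k
    exact hS i (x k)
  have htot : ∑' x : Fin m → ℤ, ∏ k, g (x k) = (∑' z, g z) ^ m := by
    set μ : Measure ℤ := Measure.sum fun z => g z • Measure.dirac z with hμ
    have hμs (z : ℤ) : μ {z} = g z := by
      rw [hμ, Measure.sum_apply _ (measurableSet_singleton z), tsum_eq_single z]
      · simp
      · intro y hy; simp [hy]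
    have hμu : μ Set.univ = ∑' z, g z := by
      rw [hμ, Measure.sum_apply _ MeasurableSet.univ]; simp
    have : IsFiniteMeasure μ := ⟨by rw [hμu]; exact hg.trans_lt hC.lt_top⟩
    have h := lintegral_countable' (μ := Measure.pi fun _ : Fin m => μ) (fun _ => 1)
    simp only [lintegral_const, one_mul, Measure.pi_univ, Measure.pi_singleton, hμs, hμu,
      Finset.prod_const, Finset.card_univ, Fintype.card_fin] at h
    exact h.symm
  calc (Fintype.card ι : ENNReal) * (9 / 10) = ∑ _i : ι, (9 / 10 : ENNReal) := by simp
    _ ≤ ∑ i, L.outputLaw (S i) (E i) := Finset.sum_le_sum fun i _ => hL i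
    _ ≤ ∑ i, ∑' x : Fin m → ℤ, (∏ k, g (x k)) * L.hyp x (E i) :=
        Finset.sum_le_sum fun i _ => hlaw i
    -- With the sample fixed outside, the disjoint events `E i` share total probability at most 1,
    -- and only the mass of the product weight remains.
    _ = ∑' x : Fin m → ℤ, (∏ k, g (x k)) * ∑ i, L.hyp x (E i) := by
        rw [← Summable.tsum_finsetSum fun _ _ => ENNReal.summable]
        simp_rw [Finset.mul_sum]
    _ ≤ ∑' x : Fin m → ℤ, ∏ k, g (x k) := by
        refine ENNReal.tsum_le_tsum fun x => mul_le_of_le_one_right' ?_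
        calc ∑ i, L.hyp x (E i) = L.hyp x (⋃ i, E i) := by
              rw [measure_iUnion hdisj hEm, tsum_fintype]
          _ ≤ 1 := prob_le_one
    _ ≤ C ^ m := by rw [htot]; gcongr

/-! ### Smoothness of fair binomial weights -/

/-- The probability that a fair binomial variable with `n` trials equals `k`. -/
noncomputable def fairBinomial : ℕ → ℤ → ℝ
  | 0, k => if k = 0 then 1 else 0
  | n + 1, k => (fairBinomial n k + fairBinomial n (k - 1)) / 2

theorem fairBinomial_nonneg (n : ℕ) (k : ℤ) : 0 ≤ fairBinomial n k := by
  induction n generalizing k with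
  | zero => unfold fairBinomial; split_ifs <;> norm_num
  | succ n ih =>
    unfold fairBinomial
    have := ih k
    have := ih (k - 1)
    positivity

theorem HasSum.congr_of_eq {f g : ℤ → ℝ} {a b : ℝ} (h : HasSum f a) (hf : ∀ k, g k = f k)
    (ha : a = b) : HasSum g b := by
  rwa [funext hf, ← ha]

theorem HasSum.int_sub_one {f : ℤ → ℝ} {a : ℝ} (h : HasSum f a) :
    HasSum (fun k => f (k - 1)) a :=
  (Equiv.subRight (1 : ℤ)).hasSum_iff.2 h

theorem hasSum_fairBinomial (n : ℕ) : HasSum (fairBinomial n) 1 := by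
  induction n with
  | zero => simpa [funext_iff, fairBinomial] using hasSum_ite_eq (0 : ℤ) (1 : ℝ)
  | succ n ih => exact ((ih.add ih.int_sub_one).div_const 2).congr_of_eq (fun k => rfl) (by norm_num)

theorem hasSum_fairBinomial_mul_sub (n : ℕ) :
    HasSum (fun k : ℤ => fairBinomial n k * ((n : ℝ) - 2 * k)) 0 := by
  induction n with
  | zero =>
    refine (hasSum_zero (α := ℝ) (β := ℤ)).congr_of_eq (fun k => ?_) rfl
    simp only [fairBinomial]; split_ifs with h <;> simp [h]
  | succ n ih =>
    have h := (((ih.add (hasSum_fairBinomial n)).add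
      (ih.int_sub_one.sub (hasSum_fairBinomial n).int_sub_one))).div_const 2
    refine h.congr_of_eq (fun k => ?_) (by norm_num)
    simp only [fairBinomial]; push_cast; ring

theorem hasSum_fairBinomial_mul_sub_sq (n : ℕ) :
    HasSum (fun k : ℤ => fairBinomial n k * ((n : ℝ) - 2 * k) ^ 2) (n : ℝ) := by
  induction n with
  | zero =>
    refine (hasSum_zero (α := ℝ) (β := ℤ)).congr_of_eq (fun k => ?_) (by simp)
    simp only [fairBinomial]; split_ifs with h <;> simp [h]
  | succ n ih =>
    have h0 := hasSum_fairBinomial n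
    have h1 := hasSum_fairBinomial_mul_sub n
    have h := (((ih.add (h1.mul_left 2)).add h0).add
      ((ih.int_sub_one.sub (h1.int_sub_one.mul_left 2)).add h0.int_sub_one)).div_const 2
    refine h.congr_of_eq (fun k => ?_) (by push_cast; ring)
    simp only [fairBinomial]; push_cast; ring

theorem fairBinomial_succ_mul (n : ℕ) (k : ℤ) :
    (k : ℝ) * fairBinomial n k = (n + 1 - k) * fairBinomial n (k - 1) := by
  induction n generalizing k with
  | zero =>
    simp only [fairBinomial]
    split_ifs with h1 h2 h2
    · omega
    · simp [h1]
    · have : k = 1 := by omega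
      simp [this]
    · simp
  | succ n ih =>
    have h1 := ih k
    have h2 := ih (k - 1)
    simp only [fairBinomial]
    push_cast at *
    linear_combination h1 / 2 + h2 / 2

/-- This turns the discrete derivative into a first-moment density, so that the second moment for `n
+ 1` trials controls the total variation. -/
theorem fairBinomial_sub_pred (n : ℕ) (k : ℤ) :
    ((n : ℝ) + 1) * (fairBinomial n k - fairBinomial n (k - 1)) =
      2 * (fairBinomial (n + 1) k * ((n + 1 : ℕ) - 2 * k)) := by
  have h1 := fairBinomial_succ_mul n k
  simp only [fairBinomial]
  push_cast
  linear_combination 2 * h1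

/-- The total variation of a fair binomial weight is of order one over its standard deviation. -/
theorem tsum_abs_fairBinomial_sub_pred_le {n h : ℕ} (hh : 0 < h) (hn : n + 1 = h ^ 2) :
    Summable (fun k : ℤ => |fairBinomial n k - fairBinomial n (k - 1)|) ∧
      ∑' k : ℤ, |fairBinomial n k - fairBinomial n (k - 1)| ≤ 2 / h := by
  have hh' : (0 : ℝ) < h := by exact_mod_cast hh
  have hn' : (n : ℝ) + 1 = h ^ 2 := by exact_mod_cast hn
  have hsum := ((hasSum_fairBinomial_mul_sub_sq (n + 1)).div_const ((h : ℝ) ^ 3)).add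
    ((hasSum_fairBinomial (n + 1)).div_const (h : ℝ))
  have hle (k : ℤ) : |fairBinomial n k - fairBinomial n (k - 1)| ≤
      fairBinomial (n + 1) k * ((n + 1 : ℕ) - 2 * k) ^ 2 / (h : ℝ) ^ 3 +
        fairBinomial (n + 1) k / h := by
    have h1 : fairBinomial n k - fairBinomial n (k - 1) =
        2 * (fairBinomial (n + 1) k * ((n + 1 : ℕ) - 2 * k)) / (h : ℝ) ^ 2 := by
      rw [← fairBinomial_sub_pred, hn']; field_simp
    have hw := fairBinomial_nonneg (n + 1) k
    set w := fairBinomial (n + 1) k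
    set y : ℝ := ((n + 1 : ℕ) - 2 * k)
    rw [h1, abs_div, abs_mul, abs_mul, abs_of_nonneg hw, abs_of_pos (by positivity : (0:ℝ) < h ^ 2)]
    -- The inequality `2|y| ≤ y² / h + h`, with its defect written as a square; `h` is the standard
    -- deviation of `y`.
    have h2 : w * y ^ 2 / (h : ℝ) ^ 3 + w / h - |(2 : ℝ)| * (w * |y|) / h ^ 2 =
        w * (|y| - h) ^ 2 / (h : ℝ) ^ 3 := by
      rw [abs_two, ← sq_abs y]; field_simp; ring
    have h3 : 0 ≤ w * (|y| - h) ^ 2 / (h : ℝ) ^ 3 := by positivity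
    linarith
  have hs := Summable.of_nonneg_of_le (fun k => abs_nonneg _) hle hsum.summable
  refine ⟨hs, (hasSum_le hle hs.hasSum hsum).trans (le_of_eq ?_)⟩
  push_cast
  rw [hn']; field_simp; ring

/-- An upper bound for the weights `fairBinomial n (k - u)` with `u ≤ W`. -/
noncomputable def binomialEnvelope (n W : ℕ) (k : ℤ) : ℝ :=
  fairBinomial n k +
    ∑ u ∈ Finset.range W, |fairBinomial n (k - u) - fairBinomial n (k - u - 1)|

theorem binomialEnvelope_nonneg (n W : ℕ) (k : ℤ) : 0 ≤ binomialEnvelope n W k :=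
  add_nonneg (fairBinomial_nonneg n k) (Finset.sum_nonneg fun _ _ => abs_nonneg _)

/-- Telescoping from `k` to `k - u`, each increment being bounded by its absolute value. -/
theorem fairBinomial_sub_le_binomialEnvelope (n W u : ℕ) (hu : u ≤ W) (k : ℤ) :
    fairBinomial n (k - u) ≤ binomialEnvelope n W k := by
  have h1 : fairBinomial n (k - u) ≤ binomialEnvelope n u k := by
    clear hu
    induction u with
    | zero => simp [binomialEnvelope]
    | succ u ih =>
      unfold binomialEnvelope at *
      rw [Finset.sum_range_succ]
      have := neg_abs_le (fairBinomial n (k - u) - fairBinomial n (k - u - 1))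
      have e : k - ((u + 1 : ℕ) : ℤ) = k - u - 1 := by push_cast; ring
      rw [e]
      linarith
  refine h1.trans (add_le_add_right (Finset.sum_le_sum_of_subset_of_nonneg ?_ ?_) _)
  · exact Finset.range_mono hu
  · intros; positivity

theorem tsum_binomialEnvelope_le {n h : ℕ} (W : ℕ) (hh : 0 < h) (hn : n + 1 = h ^ 2)
    (hW : 2 * W ≤ h) :
    Summable (binomialEnvelope n W) ∧ ∑' k, binomialEnvelope n W k ≤ 2 := by
  obtain ⟨hs, hle⟩ := tsum_abs_fairBinomial_sub_pred_le hh hn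
  have hshift (u : ℕ) : HasSum (fun k : ℤ => |fairBinomial n (k - u) - fairBinomial n (k - u - 1)|)
      (∑' k : ℤ, |fairBinomial n k - fairBinomial n (k - 1)|) :=
    (Equiv.subRight (u : ℤ)).hasSum_iff.2 hs.hasSum
  have hE := (hasSum_fairBinomial n).add (hasSum_sum fun u (_ : u ∈ Finset.range W) => hshift u)
  have h' : HasSum (binomialEnvelope n W) _ := hE
  refine ⟨h'.summable, h'.tsum_eq.le.trans ?_⟩
  rw [Finset.sum_const, Finset.card_range, nsmul_eq_mul]
  have hh' : (0 : ℝ) < h := by exact_mod_cast hh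
  have hW' : 2 * (W : ℝ) ≤ h := by exact_mod_cast hW
  have : (W : ℝ) * (∑' k : ℤ, |fairBinomial n k - fairBinomial n (k - 1)|) ≤ W * (2 / h) := by
    gcongr
  have h2 : (W : ℝ) * (2 / h) ≤ 1 := by rw [← mul_div_assoc, div_le_one hh']; linarith
  linarith

/-! ### Sums of fair steps -/

theorem isSupportSum_zero : IsSupportSum ∅ 0 ⟨Measure.dirac (0 : ℤ), inferInstance⟩ := by
  refine ⟨fun i => i.elim0, by simp, ?_⟩
  simp only [Finset.univ_eq_empty, Finset.sum_empty, Measure.map_const, measure_univ, one_smul]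
  rfl

/-- Adding one independent summand. -/
theorem IsSupportSum.conv {A : Set ℤ} {N : ℕ} {S : ProbabilityMeasure ℤ} (h : IsSupportSum A N S)
    (ν S' : ProbabilityMeasure ℤ) (hS' : (S' : Measure ℤ) = (ν : Measure ℤ) ∗ (S : Measure ℤ)) :
    IsSupportSum (distSupport ν ∪ A) (N + 1) S' := by
  obtain ⟨ν', hA, hS⟩ := h
  refine ⟨Fin.cons ν ν', ?_, ?_⟩
  · rw [← hA]
    ext z
    simp [Fin.exists_fin_succ]
  · have hmp := (measurePreserving_piFinSuccAbove
      (fun i : Fin (N + 1) => ((Fin.cons ν ν' : Fin (N + 1) → ProbabilityMeasure ℤ) i : Measure ℤ))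
      0)
    have hsum : (fun x : Fin (N + 1) → ℤ => ∑ i, x i) =
        (fun p : ℤ × (Fin N → ℤ) => p.1 + ∑ i, p.2 i) ∘
          (MeasurableEquiv.piFinSuccAbove (fun _ => ℤ) 0) := by
      ext x
      simp [Fin.sum_univ_succ, Fin.tail]
    rw [hsum, ← Measure.map_map (by fun_prop) (by fun_prop), hmp.map_eq, hS', hS]
    simp only [Fin.cons_zero, Fin.succAbove_zero, Fin.cons_succ]
    unfold Measure.conv
    have : ((ν : Measure ℤ).prod ((Measure.pi fun i => (ν' i : Measure ℤ)).map
        fun x : Fin N → ℤ => ∑ i, x i)) =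
        ((ν : Measure ℤ).prod (Measure.pi fun i => (ν' i : Measure ℤ))).map
          (Prod.map id fun x : Fin N → ℤ => ∑ i, x i) := by
      rw [← Measure.map_prod_map _ _ (by fun_prop) (by fun_prop), Measure.map_id]
    rw [this, Measure.map_map (by fun_prop) (by fun_prop)]
    rfl

/-- The uniform distribution on `{0, a}`. -/
noncomputable def fairStep (a : ℤ) : Measure ℤ :=
  (2⁻¹ : ENNReal) • (Measure.dirac 0 + Measure.dirac a)

instance (a : ℤ) : IsProbabilityMeasure (fairStep a) := by
  constructor
  simp only [fairStep, Measure.smul_apply, Measure.add_apply, measure_univ, smul_eq_mul]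
  rw [one_add_one_eq_two, ENNReal.inv_mul_cancel (by simp) (by simp)]

theorem fairStep_zero : fairStep 0 = Measure.dirac 0 := by
  rw [fairStep, ← two_smul ENNReal, smul_smul, ENNReal.inv_mul_cancel (by simp) (by simp), one_smul]

theorem distSupport_fairStep (a : ℤ) : distSupport ⟨fairStep a, inferInstance⟩ = {0, a} := by
  ext z
  simp only [distSupport, fairStep, Set.mem_ofPred_eq, ProbabilityMeasure.coe_mk,
    Measure.smul_apply, Measure.add_apply, smul_eq_mul, measurableSet_singleton,
    Measure.dirac_apply', Set.indicator_apply, Set.mem_singleton_iff, Pi.one_apply,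
    Set.mem_insert_iff]
  by_cases h0 : 0 = z <;> by_cases ha : a = z <;>
    simp [h0, ha, eq_comm (a := z), ENNReal.inv_eq_zero]

/-- Convolution with `n` uniform distributions on `{0, a}`. -/
noncomputable def addFairSteps (a : ℤ) : ℕ → Measure ℤ → Measure ℤ
  | 0, μ => μ
  | n + 1, μ => fairStep a ∗ addFairSteps a n μ

instance (a : ℤ) (n : ℕ) (μ : Measure ℤ) [IsProbabilityMeasure μ] :
    IsProbabilityMeasure (addFairSteps a n μ) := by
  induction n with
  | zero => exact ‹_›
  | succ n ih => unfold addFairSteps; infer_instance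

theorem IsSupportSum.addFairSteps {A : Set ℤ} {N : ℕ} {μ : Measure ℤ} [IsProbabilityMeasure μ]
    (h : IsSupportSum A N ⟨μ, inferInstance⟩) (a : ℤ) (n : ℕ) :
    IsSupportSum ((if n = 0 then ∅ else {0, a}) ∪ A) (N + n)
      ⟨addFairSteps a n μ, inferInstance⟩ := by
  induction n with
  | zero => simpa [_root_.addFairSteps] using h
  | succ n ih =>
    have := ih.conv ⟨fairStep a, inferInstance⟩ ⟨_root_.addFairSteps a (n + 1) μ, inferInstance⟩ rfl
    rw [distSupport_fairStep] at this
    have e : (if n + 1 = 0 then ∅ else {0, a}) ∪ A =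
        {0, a} ∪ ((if n = 0 then ∅ else {0, a}) ∪ A) := by
      split_ifs <;> simp_all [← Set.union_assoc]
    rw [e]
    exact this

/-- Steps of length `0` serve as padding: they raise the number of summands and leave the law alone.
-/
theorem addFairSteps_zero_left (n : ℕ) (μ : Measure ℤ) [IsProbabilityMeasure μ] :
    addFairSteps 0 n μ = μ := by
  induction n with
  | zero => rfl
  | succ n ih => rw [addFairSteps, ih, fairStep_zero, Measure.dirac_zero_conv]

theorem integral_fairStep_conv (a : ℤ) (μ : Measure ℤ) [IsProbabilityMeasure μ] (f : ℤ → ℂ)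
    (B : ℝ) (hf : ∀ z, ‖f z‖ ≤ B) :
    ∫ z, f z ∂(fairStep a ∗ μ) = ((∫ z, f z ∂μ) + ∫ z, f (a + z) ∂μ) / 2 := by
  have hi (ν : Measure ℤ) [IsProbabilityMeasure ν] : Integrable f ν :=
    Integrable.of_bound (by fun_prop) B (Filter.Eventually.of_forall hf)
  rw [integral_conv (hi _), fairStep, integral_smul_measure, integral_add_measure
    (integrable_dirac (by simp)) (integrable_dirac (by simp))]
  simp [div_eq_inv_mul, mul_add]

theorem fairStep_conv_real_singleton (a : ℤ) (μ : Measure ℤ) [IsProbabilityMeasure μ] (z : ℤ) :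
    (fairStep a ∗ μ).real {z} = (μ.real {z} + μ.real {z - a}) / 2 := by
  have h := integral_fairStep_conv a μ (fun x => if x = z then 1 else 0) 1
    (fun x => by split_ifs <;> simp)
  have h1 (ν : Measure ℤ) (y : ℤ) : ∫ x, (if x = y then (1 : ℂ) else 0) ∂ν = ν.real {y} := by
    have := integral_indicator_one (μ := ν) (measurableSet_singleton y)
    rw [← this, ← integral_complex_ofReal]
    congr 1 with x
    by_cases hx : x = y <;> simp [hx]
  have h2 (x : ℤ) : (if a + x = z then (1 : ℂ) else 0) = if x = z - a then 1 else 0 := by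
    congr 1; rw [eq_iff_iff]; omega
  simp only [h2, h1] at h
  exact_mod_cast h

/-- A multiplicative test function factors through the added steps. -/
theorem integral_addFairSteps (a : ℤ) (n : ℕ) (μ : Measure ℤ) [IsProbabilityMeasure μ] (f : ℤ → ℂ)
    (hf : ∀ z, ‖f z‖ ≤ 1) (hmul : ∀ x y, f (x + y) = f x * f y) :
    ∫ z, f z ∂(addFairSteps a n μ) = ((1 + f a) / 2) ^ n * ∫ z, f z ∂μ := by
  induction n with
  | zero => simp [addFairSteps]
  | succ n ih =>
    rw [addFairSteps, integral_fairStep_conv a _ f 1 hf]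
    simp_rw [hmul, integral_const_mul]
    rw [ih]
    ring

theorem addFairSteps_support_nonneg (a : ℤ) (ha : 0 ≤ a) (n : ℕ) (μ : Measure ℤ)
    [IsProbabilityMeasure μ] (B : ℤ) (hμ : ∀ z, μ.real {z} ≠ 0 → 0 ≤ z ∧ z ≤ B) (z : ℤ)
    (hz : (addFairSteps a n μ).real {z} ≠ 0) : 0 ≤ z ∧ z ≤ B + n * a := by
  induction n generalizing z with
  | zero => simpa using hμ z hz
  | succ n ih =>
    rw [addFairSteps, fairStep_conv_real_singleton] at hz
    by_cases h1 : (addFairSteps a n μ).real {z} = 0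
    · by_cases h2 : (addFairSteps a n μ).real {z - a} = 0
      · simp [h1, h2] at hz
      · have := ih _ h2
        push_cast
        constructor <;> linarith
    · have := ih _ h1
      push_cast
      constructor <;> linarith

/-- Convolution with `n` steps of length `M` as a binomial average. -/
theorem addFairSteps_real_singleton (M : ℤ) (n : ℕ) (μ : Measure ℤ) [IsProbabilityMeasure μ]
    (s : ℤ) : HasSum (fun k : ℤ => fairBinomial n k * μ.real {s - M * k})
      ((addFairSteps M n μ).real {s}) := by
  induction n generalizing s with
  | zero =>
    have := hasSum_ite_eq (0 : ℤ) (μ.real {s})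
    refine this.congr_of_eq (fun k => ?_) rfl
    simp only [fairBinomial]
    split_ifs with h <;> simp [h]
  | succ n ih =>
    rw [addFairSteps, fairStep_conv_real_singleton]
    refine (((ih s).add (ih (s - M)).int_sub_one).div_const 2).congr_of_eq (fun k => ?_) rfl
    simp only [fairBinomial]
    have : s - M - M * (k - 1) = s - M * k := by ring
    rw [this]
    ring

/-! ### Cosine estimates and Fourier inversion modulo `M` -/

theorem norm_one_add_stdAddChar_div_two (M : ℕ) [NeZero M] (j : ℤ) :
    ‖(1 + ZMod.stdAddChar (j : ZMod M)) / 2‖ = |Real.cos (Real.pi * (j / M))| := by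
  rw [ZMod.stdAddChar_coe]
  set θ : ℝ := Real.pi * (j / M) with hθ
  have h1 : (2 * Real.pi * Complex.I * j / M : ℂ) = (θ * Complex.I) + (θ * Complex.I) := by
    rw [hθ]; push_cast; ring
  have h2 : (1 + Complex.exp (θ * Complex.I + θ * Complex.I)) / 2 =
      Complex.exp (θ * Complex.I) * (Real.cos θ : ℂ) := by
    rw [Complex.ofReal_cos, Complex.cos, mul_div_assoc', mul_add, ← Complex.exp_add,
      ← Complex.exp_add]
    simp [add_comm]
  rw [h1, h2, norm_mul, Complex.norm_exp_ofReal_mul_I, one_mul, Complex.norm_real,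
    Real.norm_eq_abs]

/-- Jordan's inequality `sin (π|θ|) ≥ 2|θ|` gives `cos² ≤ 1 - 4θ² ≤ exp (-4θ²)`. -/
theorem abs_cos_pi_mul_le_exp {θ : ℝ} (h : |θ| ≤ 1 / 2) :
    |Real.cos (Real.pi * θ)| ≤ Real.exp (-(2 * θ ^ 2)) := by
  have hs : 2 * |θ| ≤ Real.sin (Real.pi * |θ|) := by
    have := Real.mul_le_sin (x := Real.pi * |θ|) (by positivity) (by nlinarith [Real.pi_pos])
    rwa [← mul_assoc, div_mul_cancel₀ _ Real.pi_ne_zero] at this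
  have hc : Real.cos (Real.pi * θ) ^ 2 ≤ Real.exp (-(2 * θ ^ 2)) ^ 2 := by
    have h1 : Real.cos (Real.pi * θ) = Real.cos (Real.pi * |θ|) := by
      rw [← Real.cos_abs, abs_mul, abs_of_pos Real.pi_pos]
    rw [h1, Real.cos_sq', ← Real.exp_nat_mul]
    have h2 := Real.add_one_le_exp (-(4 * θ ^ 2))
    have h3 : (2 * |θ|) ^ 2 ≤ Real.sin (Real.pi * |θ|) ^ 2 := by gcongr
    rw [mul_pow, sq_abs] at h3
    have h4 : ((2 : ℕ) : ℝ) * -(2 * θ ^ 2) = -(4 * θ ^ 2) := by push_cast; ring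
    rw [h4]
    linarith
  exact abs_le_of_sq_le_sq hc (Real.exp_pos _).le

/-- The chain is `cos x ≥ 1 - x²/2 ≥ 1 / (1 + x²) ≥ exp (-x²)`. -/
theorem exp_neg_sq_le_cos {x : ℝ} (h : |x| ≤ 1) : Real.exp (-x ^ 2) ≤ Real.cos x := by
  refine le_trans ?_ Real.one_sub_sq_div_two_le_cos
  have hx : x ^ 2 ≤ 1 := by rw [← sq_abs]; exact pow_le_one₀ (abs_nonneg _) h
  rw [Real.exp_neg, inv_le_comm₀ (Real.exp_pos _) (by linarith)]
  refine le_trans ?_ (Real.add_one_le_exp _)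
  rw [inv_le_iff_one_le_mul₀ (by linarith)]
  nlinarith [sq_nonneg x]

theorem abs_cos_pi_mul_add_int (θ : ℝ) (k : ℤ) :
    |Real.cos (Real.pi * (θ + k))| = |Real.cos (Real.pi * θ)| := by
  rw [mul_add, mul_comm Real.pi (k : ℝ), Real.cos_add_int_mul_pi]
  rcases Int.even_or_odd k with hk | hk
  · simp [hk.neg_one_zpow]
  · simp [hk.neg_one_zpow]

/-- The law of a residue modulo `M` is bounded by the mean of its Fourier coefficients. -/
theorem measureReal_residue_le (M : ℕ) [NeZero M] (μ : Measure ℤ) [IsProbabilityMeasure μ]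
    (s : ZMod M) :
    μ.real {z : ℤ | (z : ZMod M) = s} ≤
      (1 / M) * ∑ ξ : ZMod M, ‖∫ z : ℤ, ZMod.stdAddChar (ξ * (z : ZMod M)) ∂μ‖ := by
  have hM : (M : ℂ) ≠ 0 := by exact_mod_cast NeZero.ne M
  have hnorm (x : ZMod M) : ‖(ZMod.stdAddChar x : ℂ)‖ = 1 := by
    rw [ZMod.stdAddChar_apply, Circle.norm_coe]
  -- Orthogonality of characters expands the indicator of a residue class.
  have hind (z : ℤ) : ({z : ℤ | (z : ZMod M) = s}.indicator (fun _ => (1 : ℂ)) z) =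
      (1 / M) * ∑ ξ : ZMod M, ZMod.stdAddChar (-(ξ * s)) * ZMod.stdAddChar (ξ * (z : ZMod M)) := by
    have h := AddChar.sum_mulShift ((z : ZMod M) - s) (ZMod.isPrimitive_stdAddChar M)
    have h2 (ξ : ZMod M) : (ZMod.stdAddChar (-(ξ * s)) * ZMod.stdAddChar (ξ * (z : ZMod M)) : ℂ) =
        ZMod.stdAddChar (ξ * ((z : ZMod M) - s)) := by
      rw [← AddChar.map_add_eq_mul]; congr 1; ring
    simp_rw [h2, h, sub_eq_zero, Set.indicator_apply, Set.mem_ofPred_eq, ZMod.card]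
    split_ifs
    · simp [hM]
    · simp
  have hint : (μ.real {z : ℤ | (z : ZMod M) = s} : ℂ) =
      (1 / M) * ∑ ξ : ZMod M,
        ZMod.stdAddChar (-(ξ * s)) * ∫ z : ℤ, ZMod.stdAddChar (ξ * (z : ZMod M)) ∂μ := by
    have h1 : ∫ z : ℤ, {z : ℤ | (z : ZMod M) = s}.indicator (fun _ => (1 : ℂ)) z ∂μ =
        μ.real {z : ℤ | (z : ZMod M) = s} := by
      rw [integral_indicator_const _ (Set.to_countable _).measurableSet]; simp
    rw [← h1]
    simp_rw [hind, integral_const_mul]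
    rw [integral_finsetSum]
    · simp_rw [integral_const_mul]
    · intro ξ _
      exact Integrable.of_bound (by fun_prop) 1 (Filter.Eventually.of_forall fun z => by
        simp [hnorm])
  have := congrArg norm hint
  rw [Complex.norm_real, Real.norm_of_nonneg measureReal_nonneg] at this
  rw [this, norm_mul]
  have e : ‖(1 / M : ℂ)‖ = 1 / M := by simp
  rw [e]
  gcongr
  refine (norm_sum_le _ _).trans (Finset.sum_le_sum fun ξ _ => ?_)
  rw [norm_mul, hnorm, one_mul]

/-! ### Fourier mass of a well-rounded lattice -/

theorem summable_exp_neg_abs_div : Summable fun x : ℤ => Real.exp (-(|(x : ℝ)| / 18)) := by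
  have h : Summable fun n : ℕ => Real.exp (-(|((n : ℤ) : ℝ)| / 18)) := by
    have := Real.summable_exp_nat_mul_iff.2 (show (-(1 / 18) : ℝ) < 0 by norm_num)
    refine this.congr fun n => ?_
    rw [Int.cast_natCast, Nat.abs_cast]
    ring_nf
  exact Summable.of_nat_of_neg h (by simpa using h)

/-- The mass of the discrete exponential weight on `ℤ × ℤ`. -/
noncomputable def latticeMass : ℝ := (∑' x : ℤ, Real.exp (-(|(x : ℝ)| / 18))) ^ 2

theorem one_le_latticeMass : 1 ≤ latticeMass := by
  refine one_le_pow₀ ?_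
  have := summable_exp_neg_abs_div.le_tsum 0 (fun _ _ => (Real.exp_pos _).le)
  simpa using this

theorem sum_exp_le_latticeMass {ι : Type*} (s : Finset ι) (p : ι → ℤ × ℤ)
    (hp : Function.Injective p) :
    ∑ i ∈ s, Real.exp (-((|((p i).1 : ℝ)| + |((p i).2 : ℝ)|) / 18)) ≤ latticeMass := by
  have hs := summable_exp_neg_abs_div
  have hprod := hs.mul_of_nonneg hs (fun _ => (Real.exp_pos _).le) (fun _ => (Real.exp_pos _).le)
  have h1 : latticeMass = ∑' q : ℤ × ℤ,
      Real.exp (-(|(q.1 : ℝ)| / 18)) * Real.exp (-(|(q.2 : ℝ)| / 18)) := by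
    rw [latticeMass, sq, hs.tsum_mul_tsum hs hprod]
  have h2 (i : ι) : Real.exp (-((|((p i).1 : ℝ)| + |((p i).2 : ℝ)|) / 18)) =
      Real.exp (-(|((p i).1 : ℝ)| / 18)) * Real.exp (-(|((p i).2 : ℝ)| / 18)) := by
    rw [← Real.exp_add]; ring_nf
  simp_rw [h2]
  classical
  rw [h1, ← Finset.sum_image (f := fun q : ℤ × ℤ =>
    Real.exp (-(|(q.1 : ℝ)| / 18)) * Real.exp (-(|(q.2 : ℝ)| / 18))) (s := s) (g := p)
    (fun _ _ _ _ h => hp h)]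
  exact hprod.sum_le_tsum _ (fun _ _ => by positivity)

/-- In the lattice `{(ξ, η) | η ≡ v ξ mod M}`, the coordinates `x, y` with respect to the basis
`(a, σ b), (a + a', - σ b')` are controlled by `ξ / a` and `η / b`. -/
theorem lattice_coordinates_bound {a a' b b' σ : ℤ} (hab' : 0 ≤ a')
    (hb : 0 < b) (hbb : b ≤ 2 * b') (hσ : σ ^ 2 = 1) (x y : ℤ) :
    (|x| + |y|) * a ≤ |x * a + y * (a + a')| ∨
      (|x| + |y|) * b ≤ 2 * |σ * (x * b - y * b')| := by
  have hσ' : |σ| = 1 := by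
    rw [← pow_eq_one_iff_of_nonneg (abs_nonneg σ) two_ne_zero, sq_abs, hσ]
  rw [abs_mul, hσ', one_mul]
  -- Equal signs exclude cancellation in the first coordinate, opposite signs in the second; there
  -- `b ≤ 2 * b'` costs the factor 2.
  rcases abs_cases x with ⟨hx, hx'⟩ | ⟨hx, hx'⟩ <;> rcases abs_cases y with ⟨hy, hy'⟩ | ⟨hy, hy'⟩ <;>
    rw [hx, hy]
  · left
    refine le_trans ?_ (le_abs_self _)
    nlinarith [mul_nonneg hy' hab']
  · right
    refine le_trans ?_ (mul_le_mul_of_nonneg_left (le_abs_self _) (by norm_num))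
    nlinarith [mul_nonneg hx' hb.le]
  · right
    refine le_trans ?_ (mul_le_mul_of_nonneg_left (neg_le_abs _) (by norm_num))
    nlinarith [mul_nonneg hy' hb.le, mul_pos_of_neg_of_neg hx' (neg_neg_of_pos hb)]
  · left
    refine le_trans ?_ (neg_le_abs _)
    nlinarith [mul_nonneg (neg_nonneg.2 hy'.le) hab']

/-- Fourier mass at the scale `(a, b)` of a lattice `{(ξ, η) | η ≡ v ξ mod M}` that is well
rounded at this scale. -/
theorem sum_abs_cos_le_latticeMass {M : ℕ} [NeZero M] {v : ℤ} {a b : ℕ} {a' b' σ : ℤ}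
    (ha' : 0 ≤ a') (haa : a' ≤ a) (ha : 0 < a) (hb : 0 < b) (hbb' : b' ≤ b) (hbb : b ≤ 2 * b')
    (hσ : σ ^ 2 = 1) (hdet : (a : ℤ) * a - a' * (a + a') = σ)
    (hM : (M : ℤ) = a' * b + a * (b + b')) (hv : v = a' * b' + a * b) :
    ∑ ξ : ZMod M, |Real.cos (Real.pi * ((ξ.valMinAbs : ℤ) / M))| ^ b ^ 2 *
      |Real.cos (Real.pi * ((ξ.valMinAbs * v : ℤ) / M))| ^ a ^ 2 ≤ latticeMass := by
  have hM0 : (0 : ℝ) < M := by exact_mod_cast NeZero.pos M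
  -- Subtracting `M * k ξ` reduces `ξ * v` to its least residue. The pair `p ξ` holds the lattice
  -- coordinates, found by inverting a 2 × 2 matrix of determinant `σ = ±1`; they are therefore
  -- integers.
  set k : ZMod M → ℤ := fun ξ => round (((ξ.valMinAbs * v : ℤ) : ℝ) / M) with hk
  set p : ZMod M → ℤ × ℤ := fun ξ =>
    (σ * (ξ.valMinAbs * a - k ξ * (a + a')), σ * (k ξ * a - ξ.valMinAbs * a')) with hp
  have hξ (ξ : ZMod M) : ξ.valMinAbs = (p ξ).1 * a + (p ξ).2 * (a + a') := by
    simp only [hp]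
    linear_combination (-ξ.valMinAbs) * hσ - σ * ξ.valMinAbs * hdet
  have hη (ξ : ZMod M) : ξ.valMinAbs * v - M * k ξ = σ * ((p ξ).1 * b - (p ξ).2 * b') := by
    have hkk : k ξ = (p ξ).1 * a' + (p ξ).2 * a := by
      simp only [hp]
      linear_combination (-k ξ) * hσ - σ * k ξ * hdet
    rw [hkk, hv, hM]
    nth_rewrite 1 [hξ ξ]
    rw [← hdet]
    ring
  have hpinj : Function.Injective p := fun ξ ξ' h => by
    refine ZMod.injective_valMinAbs ?_
    rw [hξ, hξ ξ', h]
  refine le_trans (Finset.sum_le_sum fun ξ _ => ?_) (sum_exp_le_latticeMass Finset.univ p hpinj)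
  set X : ℤ := ξ.valMinAbs with hX
  set Y : ℤ := X * v - M * k ξ with hY
  have hXb : |(X : ℝ) / M| ≤ 1 / 2 := by
    have h1 := ZMod.natAbs_valMinAbs_le ξ
    have h2 : 2 * |X| ≤ M := by rw [← hX] at h1; clear hM; rw [Int.abs_eq_natAbs]; omega
    have h3 : 2 * |(X : ℝ)| ≤ M := by exact_mod_cast h2
    rw [abs_div, abs_of_pos hM0, div_le_iff₀ hM0]
    linarith
  have hYeq : ((X * v : ℤ) : ℝ) / M = (Y : ℝ) / M + k ξ := by
    rw [hY]; push_cast; field_simp; ring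
  have hYb : |(Y : ℝ) / M| ≤ 1 / 2 := by
    have h1 := abs_sub_round (((X * v : ℤ) : ℝ) / M)
    have h2 : (round (((X * v : ℤ) : ℝ) / M)) = k ξ := rfl
    rw [h2] at h1
    rwa [hYeq, add_sub_cancel_right] at h1
  have hM3 : (M : ℝ) ≤ 3 * a * b := by
    have : (M : ℤ) ≤ 3 * a * b := by
      rw [hM]
      nlinarith [mul_le_mul_of_nonneg_right haa (Int.natCast_nonneg b),
        mul_le_mul_of_nonneg_left hbb' (Int.natCast_nonneg a)]
    exact_mod_cast this
  rw [hYeq, abs_cos_pi_mul_add_int]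
  calc _ ≤ Real.exp (-(2 * ((X : ℝ) / M) ^ 2)) ^ b ^ 2 *
        Real.exp (-(2 * ((Y : ℝ) / M) ^ 2)) ^ a ^ 2 := by
        gcongr
        · exact abs_cos_pi_mul_le_exp hXb
        · exact abs_cos_pi_mul_le_exp hYb
    _ = Real.exp (-(2 * (b * X / M) ^ 2 + 2 * (a * Y / M) ^ 2)) := by
        rw [← Real.exp_nat_mul, ← Real.exp_nat_mul, ← Real.exp_add]
        congr 1; push_cast; ring
    _ ≤ _ := by
        rw [Real.exp_le_exp, neg_le_neg_iff]
        have hcase := lattice_coordinates_bound (a := a) (b := b) ha'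
          (by exact_mod_cast hb) hbb hσ (p ξ).1 (p ξ).2
        rw [← hξ, ← hη] at hcase
        set t : ℤ := |(p ξ).1| + |(p ξ).2| with ht
        have ht0 : 0 ≤ t := by positivity
        -- Integrality of `t` weakens Gaussian decay to exponential decay, which splits as a product
        -- over the two coordinates. The rate `1/18` is `2/36` from `hstep`.
        have ht2 : (t : ℝ) ≤ t ^ 2 := by
          have : t ≤ t ^ 2 := by nlinarith [Int.le_self_sq t]
          exact_mod_cast this
        have htr : |((p ξ).1 : ℝ)| + |((p ξ).2 : ℝ)| = t := by rw [ht]; push_cast; rfl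
        rw [htr]
        have ht0' : (0 : ℝ) ≤ t := by exact_mod_cast ht0
        have hstep : (t : ℝ) ^ 2 / 36 ≤ (b * X / M) ^ 2 ∨ (t : ℝ) ^ 2 / 36 ≤ (a * Y / M) ^ 2 := by
          refine hcase.imp (fun h => ?_) (fun h => ?_)
          · have h' : (t : ℝ) * a ≤ |(X : ℝ)| := by exact_mod_cast h
            have h2 : (t : ℝ) / 6 ≤ b * |(X : ℝ)| / M := by
              rw [le_div_iff₀ hM0]
              calc (t : ℝ) / 6 * M ≤ t / 6 * (3 * a * b) := by gcongr
                _ = b * (t * a) / 2 := by ring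
                _ ≤ b * (t * a) := half_le_self (by positivity)
                _ ≤ b * |(X : ℝ)| := by gcongr
            calc (t : ℝ) ^ 2 / 36 = (t / 6) ^ 2 := by ring
              _ ≤ (b * |(X : ℝ)| / M) ^ 2 := by gcongr
              _ = _ := by rw [div_pow, mul_pow, sq_abs, ← mul_pow, ← div_pow]
          · have h' : (t : ℝ) * b ≤ 2 * |(Y : ℝ)| := by exact_mod_cast h
            have h2 : (t : ℝ) / 6 ≤ a * |(Y : ℝ)| / M := by
              rw [le_div_iff₀ hM0]
              calc (t : ℝ) / 6 * M ≤ t / 6 * (3 * a * b) := by gcongr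
                _ = a * (t * b / 2) := by ring
                _ ≤ a * |(Y : ℝ)| := by gcongr; linarith
            calc (t : ℝ) ^ 2 / 36 = (t / 6) ^ 2 := by ring
              _ ≤ (a * |(Y : ℝ)| / M) ^ 2 := by gcongr
              _ = _ := by rw [div_pow, mul_pow, sq_abs, ← mul_pow, ← div_pow]
        have hp1 : 0 ≤ (b * X / M : ℝ) ^ 2 := sq_nonneg _
        have hp2 : 0 ≤ (a * Y / M : ℝ) ^ 2 := sq_nonneg _
        rcases hstep with h | h <;> linarith

/-! ### Domination by a common weight -/

/-- Adding many steps of length `M` spreads a law over its residue classes modulo `M`. -/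
theorem addFairSteps_real_singleton_le {M : ℕ} [NeZero M] (n W : ℕ) (μ : Measure ℤ)
    [IsProbabilityMeasure μ] (hμ : ∀ z, μ.real {z} ≠ 0 → 0 ≤ z ∧ z ≤ M * W) {D : ℝ}
    (hD : ∀ s : ZMod M, μ.real {z : ℤ | (z : ZMod M) = s} ≤ D) (s : ℤ) :
    (addFairSteps M n μ).real {s} ≤ D * binomialEnvelope n W (s / M) := by
  have hM : (0 : ℤ) < M := by exact_mod_cast NeZero.pos M
  refine hasSum_le_of_sum_le (addFairSteps_real_singleton M n μ s) fun F => ?_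
  -- Only `k` with `0 ≤ s - M * k ≤ M * W` contribute, so `k` is `s / M` lowered by at most `W`, the
  -- range that the envelope covers.
  have h1 (k : ℤ) : fairBinomial n k * μ.real {s - M * k} ≤
      binomialEnvelope n W (s / M) * μ.real {s - M * k} := by
    by_cases hk : μ.real {s - M * k} = 0
    · simp [hk]
    · obtain ⟨h0, hW⟩ := hμ _ hk
      refine mul_le_mul_of_nonneg_right ?_ measureReal_nonneg
      have hr := Int.emod_add_mul_ediv s M
      have hr0 := Int.emod_nonneg s hM.ne'
      have hr1 := Int.emod_lt_of_pos s hM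
      have hq0 : 0 ≤ s / M - k := by
        by_contra! hneg
        have : M * (s / M - k) ≤ M * (-1 : ℤ) := mul_le_mul_of_nonneg_left (by omega) hM.le
        linarith
      have hqW : s / M - k ≤ W := by
        refine le_of_mul_le_mul_left ?_ hM
        linarith
      have h := fairBinomial_sub_le_binomialEnvelope n W (s / M - k).toNat (by omega) (s / M)
      rwa [Int.toNat_of_nonneg hq0, sub_sub_cancel] at h
  have hinj : Function.Injective fun k : ℤ => s - M * k := fun k l h => by
    have : (M : ℤ) * k = M * l := by simpa using h
    exact mul_left_cancel₀ hM.ne' this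
  calc ∑ k ∈ F, fairBinomial n k * μ.real {s - M * k}
      ≤ ∑ k ∈ F, binomialEnvelope n W (s / M) * μ.real {s - M * k} :=
        Finset.sum_le_sum fun k _ => h1 k
    _ = binomialEnvelope n W (s / M) * μ.real ((F.image fun k : ℤ => s - M * k : Finset ℤ)) := by
        rw [← Finset.mul_sum, ← sum_measureReal_singleton, Finset.sum_image hinj.injOn]
    _ ≤ binomialEnvelope n W (s / M) * D := by
        refine mul_le_mul_of_nonneg_left ((measureReal_mono ?_).trans (hD (s : ZMod M)))
          (binomialEnvelope_nonneg _ _ _)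
        intro z hz
        simp only [Finset.coe_image, Set.mem_image] at hz
        obtain ⟨k, -, rfl⟩ := hz
        simp
    _ = _ := mul_comm _ _

/-- Each quotient `s / M` is taken by exactly `M` integers, which cancels the factor `1 / M`. -/
theorem tsum_ofReal_binomialEnvelope_ediv_le {M : ℕ} [NeZero M] {n h W : ℕ} (hh : 0 < h)
    (hn : n + 1 = h ^ 2) (hW : 2 * W ≤ h) {C : ℝ} (hC : 0 ≤ C) :
    ∑' s : ℤ, ENNReal.ofReal (C / M * binomialEnvelope n W (s / M)) ≤ ENNReal.ofReal (2 * C) := by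
  obtain ⟨hs, hle⟩ := tsum_binomialEnvelope_le W hh hn hW
  have hM : (0 : ℝ) < M := by exact_mod_cast NeZero.pos M
  have e : ∀ p : ℤ × Fin M, ((Int.divModEquiv M).symm p) / (M : ℤ) = p.1 := fun p => by
    have h1 := congrArg Prod.fst ((Int.divModEquiv M).apply_symm_apply p)
    simpa [Int.divModEquiv] using h1
  rw [← (Int.divModEquiv M).symm.tsum_eq]
  simp_rw [e]
  rw [ENNReal.tsum_prod (f := fun k (_ : Fin M) =>
    ENNReal.ofReal (C / M * binomialEnvelope n W k))]
  simp_rw [tsum_fintype, Finset.sum_const, Finset.card_univ, Fintype.card_fin, nsmul_eq_mul]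
  have h1 (k : ℤ) : (M : ENNReal) * ENNReal.ofReal (C / M * binomialEnvelope n W k) =
      ENNReal.ofReal (C * binomialEnvelope n W k) := by
    rw [← ENNReal.ofReal_natCast, ← ENNReal.ofReal_mul hM.le]
    congr 1; field_simp
  simp_rw [h1]
  rw [← ENNReal.ofReal_tsum_of_nonneg
    (fun k => mul_nonneg hC (binomialEnvelope_nonneg _ _ _)) (hs.mul_left C), tsum_mul_left]
  apply ENNReal.ofReal_le_ofReal
  rw [mul_comm 2 C]
  gcongr

/-! ### Fourier coefficients and supports of the coarse laws -/

/-- The law of a sum of fair steps: `p` of length `0`, `n₂` of length `v`, `n₁` of length `1`. -/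
noncomputable def coarseLaw (v : ℤ) (n₁ n₂ p : ℕ) : Measure ℤ :=
  addFairSteps 1 n₁ (addFairSteps v n₂ (addFairSteps 0 p (Measure.dirac 0)))

instance (v : ℤ) (n₁ n₂ p : ℕ) : IsProbabilityMeasure (coarseLaw v n₁ n₂ p) := by
  unfold coarseLaw; infer_instance

theorem stdAddChar_mul_intCast_add {M : ℕ} [NeZero M] (ξ : ZMod M) (x y : ℤ) :
    (ZMod.stdAddChar (ξ * ((x + y : ℤ) : ZMod M)) : ℂ) =
      ZMod.stdAddChar (ξ * (x : ZMod M)) * ZMod.stdAddChar (ξ * (y : ZMod M)) := by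
  rw [← AddChar.map_add_eq_mul]; push_cast; ring_nf

theorem norm_stdAddChar {M : ℕ} [NeZero M] (x : ZMod M) : ‖(ZMod.stdAddChar x : ℂ)‖ = 1 := by
  rw [ZMod.stdAddChar_apply, Circle.norm_coe]

theorem norm_integral_stdAddChar_coarseLaw {M : ℕ} [NeZero M] (v : ℤ) (n₁ n₂ p : ℕ) (j : ℤ) :
    ‖∫ z : ℤ, ZMod.stdAddChar ((j : ZMod M) * (z : ZMod M)) ∂(coarseLaw v n₁ n₂ p)‖ =
      |Real.cos (Real.pi * (j / M))| ^ n₁ * |Real.cos (Real.pi * ((j * v : ℤ) / M))| ^ n₂ := by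
  set f : ℤ → ℂ := fun z => ZMod.stdAddChar ((j : ZMod M) * (z : ZMod M)) with hf
  have hn (z : ℤ) : ‖f z‖ ≤ 1 := (norm_stdAddChar _).le
  have hmul (x y : ℤ) : f (x + y) = f x * f y := stdAddChar_mul_intCast_add _ x y
  have h0 : ∫ z, f z ∂(Measure.dirac (0 : ℤ)) = 1 := by simp [hf]
  have hstep (a : ℤ) : ‖(1 + f a) / 2‖ = |Real.cos (Real.pi * ((j * a : ℤ) / M))| := by
    rw [← norm_one_add_stdAddChar_div_two]; simp [hf]
  rw [coarseLaw, addFairSteps_zero_left, integral_addFairSteps 1 n₁ _ f hn hmul,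
    integral_addFairSteps v n₂ _ f hn hmul, h0, norm_mul, norm_mul, norm_pow, norm_pow, hstep,
    hstep]
  simp

/-- A character modulo `M` is trivial at `M`, so smoothing by such steps costs nothing in the
separation of the targets. -/
theorem integral_stdAddChar_addFairSteps_self {M : ℕ} [NeZero M] (n : ℕ) (μ : Measure ℤ)
    [IsProbabilityMeasure μ] (ξ : ZMod M) :
    ∫ z : ℤ, ZMod.stdAddChar (ξ * (z : ZMod M)) ∂(addFairSteps M n μ) =
      ∫ z : ℤ, ZMod.stdAddChar (ξ * (z : ZMod M)) ∂μ := by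
  have h := integral_addFairSteps M n μ (fun z => ZMod.stdAddChar (ξ * (z : ZMod M)))
    (fun z => (norm_stdAddChar _).le) (stdAddChar_mul_intCast_add ξ)
  simpa using h

theorem coarseLaw_support {v : ℤ} (hv : 0 ≤ v) (n₁ n₂ p : ℕ) (z : ℤ)
    (hz : (coarseLaw v n₁ n₂ p).real {z} ≠ 0) : 0 ≤ z ∧ z ≤ n₂ * v + n₁ := by
  rw [coarseLaw, addFairSteps_zero_left] at hz
  have h0 (z : ℤ) (h : (Measure.dirac (0 : ℤ)).real {z} ≠ 0) : 0 ≤ z ∧ z ≤ 0 := by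
    by_cases hz : z = 0
    · simp [hz]
    · exact absurd (by simp [Measure.real, Ne.symm hz]) h
  have := addFairSteps_support_nonneg 1 zero_le_one n₁ _ _
    (addFairSteps_support_nonneg v hv n₂ _ 0 h0) z hz
  simpa using this

theorem isSupportSum_addFairSteps_coarseLaw (M v : ℤ) {n n₁ n₂ : ℕ} (p : ℕ) (hn : n ≠ 0)
    (h₁ : n₁ ≠ 0) (h₂ : n₂ ≠ 0) :
    IsSupportSum {0, 1, v, M} (n₁ + n₂ + n + p)
      ⟨addFairSteps M n (coarseLaw v n₁ n₂ p), inferInstance⟩ := by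
  have h := (((isSupportSum_zero.addFairSteps 0 p).addFairSteps v n₂).addFairSteps 1
    n₁).addFairSteps M n
  have hA : ({0, M} : Set ℤ) ∪ ({0, 1} ∪ ({0, v} ∪ ((if p = 0 then ∅ else {0, 0}) ∪ ∅))) =
      {0, 1, v, M} := by
    ext z
    split_ifs <;> simp <;> tauto
  simp only [hn, h₁, h₂, if_false, hA] at h
  have hN : 0 + p + n₂ + n₁ + n = n₁ + n₂ + n + p := by ring
  rw [hN] at h
  exact h

/-! ### The Fibonacci family -/

theorem Nat.fib_cassini (n : ℕ) :
    (Nat.fib (n + 1) : ℤ) * Nat.fib (n + 1) - Nat.fib n * (Nat.fib (n + 1) + Nat.fib n) =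
      (-1) ^ n := by
  induction n with
  | zero => simp
  | succ n ih =>
    rw [Nat.fib_add_two, pow_succ, ← ih]
    push_cast
    ring

/-- A sum that is concentrated near the multiples of `M / fib j`, for `M = fib (j + l)`. -/
noncomputable def fibLaw (j l : ℕ) (p : ℕ) : Measure ℤ :=
  coarseLaw (Nat.fib (j + l - 1)) (Nat.fib l ^ 2) (Nat.fib j ^ 2) p

instance (j l p : ℕ) : IsProbabilityMeasure (fibLaw j l p) := by
  unfold fibLaw; infer_instance

theorem Nat.fib_add_eq_mul_add_mul {j l : ℕ} (hj : 1 ≤ j) (hl : 1 ≤ l) :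
    (Nat.fib (j + l) : ℤ) = Nat.fib (j - 1) * Nat.fib l +
      Nat.fib j * (Nat.fib l + Nat.fib (l - 1)) := by
  obtain ⟨i, rfl⟩ := Nat.exists_eq_add_of_le' hj
  obtain ⟨k, rfl⟩ := Nat.exists_eq_add_of_le' hl
  have h := Nat.fib_add i (k + 1)
  rw [show i + 1 + (k + 1) = i + (k + 1) + 1 by ring, h, Nat.fib_add_two]
  simp only [Nat.add_sub_cancel]
  push_cast
  ring

theorem Nat.fib_add_sub_one_eq {j l : ℕ} (hj : 1 ≤ j) (hl : 1 ≤ l) :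
    (Nat.fib (j + l - 1) : ℤ) = Nat.fib (j - 1) * Nat.fib (l - 1) + Nat.fib j * Nat.fib l := by
  obtain ⟨i, rfl⟩ := Nat.exists_eq_add_of_le' hj
  obtain ⟨k, rfl⟩ := Nat.exists_eq_add_of_le' hl
  rw [show i + 1 + (k + 1) - 1 = i + k + 1 by omega, Nat.fib_add]
  simp

theorem Nat.fib_le_two_mul_fib_sub_one {l : ℕ} (hl : 2 ≤ l) :
    Nat.fib l ≤ 2 * Nat.fib (l - 1) := by
  obtain ⟨k, rfl⟩ := Nat.exists_eq_add_of_le' hl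
  have := Nat.fib_mono (Nat.le_succ k)
  rw [Nat.fib_add_two]
  simp only [Nat.succ_eq_add_one, show k + 2 - 1 = k + 1 by omega] at *
  omega

theorem Nat.fib_mul_fib_le_fib_add {j l : ℕ} (hj : 1 ≤ j) (hl : 1 ≤ l) :
    Nat.fib j * Nat.fib l ≤ Nat.fib (j + l) := by
  have h := Nat.fib_add_eq_mul_add_mul hj hl
  have : (Nat.fib j * Nat.fib l : ℤ) ≤ Nat.fib (j + l) := by
    rw [h, mul_add]
    have h1 : (0 : ℤ) ≤ Nat.fib (j - 1) * Nat.fib l := by positivity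
    have h2 : (0 : ℤ) ≤ Nat.fib j * Nat.fib (l - 1) := by positivity
    linarith
  exact_mod_cast this

theorem Nat.fib_add_le_three_mul {j l : ℕ} (hj : 1 ≤ j) (hl : 1 ≤ l) :
    Nat.fib (j + l) ≤ 3 * (Nat.fib j * Nat.fib l) := by
  have h := Nat.fib_add_eq_mul_add_mul hj hl
  have h1 : Nat.fib (j - 1) * Nat.fib l ≤ Nat.fib j * Nat.fib l :=
    Nat.mul_le_mul_right _ (Nat.fib_mono (Nat.sub_le _ _))
  have h2 : Nat.fib j * Nat.fib (l - 1) ≤ Nat.fib j * Nat.fib l :=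
    Nat.mul_le_mul_left _ (Nat.fib_mono (Nat.sub_le _ _))
  zify at *
  linarith

/-- The lattice bound applies at scale `(fib j, fib l)`, with the preceding Fibonacci numbers as
`a'` and `b'`; Cassini's identity supplies the determinant. The bound is the same at every level. -/
theorem fibLaw_residue_le {j l : ℕ} (hj : 1 ≤ j) (hl : 2 ≤ l) (p : ℕ) {M : ℕ} [NeZero M]
    (hM : M = Nat.fib (j + l)) (s : ZMod M) :
    (fibLaw j l p).real {z : ℤ | (z : ZMod M) = s} ≤ latticeMass / M := by
  refine (measureReal_residue_le M _ s).trans ?_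
  rw [one_div, inv_mul_eq_div]
  gcongr
  have hone : 1 ≤ l := by omega
  have hdet := Nat.fib_cassini (j - 1)
  rw [Nat.sub_add_cancel hj] at hdet
  have h := sum_abs_cos_le_latticeMass (M := M) (v := (Nat.fib (j + l - 1) : ℤ)) (a := Nat.fib j)
    (b := Nat.fib l) (a' := Nat.fib (j - 1)) (b' := Nat.fib (l - 1)) (σ := (-1) ^ (j - 1))
    (by positivity) (by exact_mod_cast Nat.fib_mono (Nat.sub_le _ _))
    (Nat.fib_pos.2 hj) (Nat.fib_pos.2 hone) (by exact_mod_cast Nat.fib_mono (Nat.sub_le _ _))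
    (by exact_mod_cast Nat.fib_le_two_mul_fib_sub_one hl)
    (by rw [← pow_mul, mul_comm, pow_mul]; simp) hdet
    (by rw [hM]; exact Nat.fib_add_eq_mul_add_mul hj hone)
    (Nat.fib_add_sub_one_eq hj hone)
  refine le_trans (Finset.sum_le_sum fun ξ _ => le_of_eq ?_) h
  rw [← norm_integral_stdAddChar_coarseLaw, ZMod.coe_valMinAbs]
  rfl

theorem fibLaw_support {j l : ℕ} (p : ℕ) {M : ℕ} (hM : M = Nat.fib (j + l)) (z : ℤ)
    (hz : (fibLaw j l p).real {z} ≠ 0) : 0 ≤ z ∧ z ≤ M * ((M ^ 2 + M : ℕ) : ℤ) := by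
  obtain ⟨h0, h1⟩ := coarseLaw_support (by positivity) _ _ _ z hz
  refine ⟨h0, h1.trans ?_⟩
  have hl : Nat.fib l ≤ M := hM ▸ Nat.fib_mono (by omega)
  have hj : Nat.fib j ≤ M := hM ▸ Nat.fib_mono (by omega)
  have hv : Nat.fib (j + l - 1) ≤ M := hM ▸ Nat.fib_mono (by omega)
  have : Nat.fib j ^ 2 * Nat.fib (j + l - 1) + Nat.fib l ^ 2 ≤ M ^ 2 * M + M ^ 2 := by gcongr
  have e : M * (M ^ 2 + M) = M ^ 2 * M + M ^ 2 := by ring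
  rw [← e] at this
  exact_mod_cast this

theorem Nat.le_fib_of_eight_le {n : ℕ} (hn : 8 ≤ n) : 21 ≤ Nat.fib n :=
  (show 21 = Nat.fib 8 by rfl).le.trans (Nat.fib_mono hn)

/-- The character of frequency `fib j` is visible at level `j`. -/
theorem exp_le_norm_integral_fibLaw_self {j l : ℕ} (hj : 8 ≤ j) (hl : 8 ≤ l) (p : ℕ) {M : ℕ}
    [NeZero M] (hM : M = Nat.fib (j + l)) :
    Real.exp (-20) ≤
      ‖∫ z : ℤ, ZMod.stdAddChar (((Nat.fib j : ℤ) : ZMod M) * (z : ZMod M)) ∂(fibLaw j l p)‖ := by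
  rw [fibLaw, norm_integral_stdAddChar_coarseLaw]
  have hM0 : (0 : ℝ) < M := by exact_mod_cast NeZero.pos M
  have ha := Nat.le_fib_of_eight_le hj
  have hb := Nat.le_fib_of_eight_le hl
  have hab : Nat.fib j * Nat.fib l ≤ M :=
    hM ▸ Nat.fib_mul_fib_le_fib_add (by omega) (by omega)
  -- By Cassini, `fib j * fib (j + l - 1) ≡ ± fib l` modulo `M`.
  have hshift : |Real.cos (Real.pi * (((Nat.fib j : ℤ) * (Nat.fib (j + l - 1) : ℤ) : ℤ) / M))| =
      |Real.cos (Real.pi * ((Nat.fib l : ℤ) / M))| := by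
    have h1 := Nat.fib_add_sub_one_eq (j := j) (l := l) (by omega) (by omega)
    have h2 := Nat.fib_add_eq_mul_add_mul (j := j) (l := l) (by omega) (by omega)
    have h3 := Nat.fib_cassini (j - 1)
    rw [Nat.sub_add_cancel (by omega)] at h3
    have h4 : (Nat.fib j : ℤ) * Nat.fib (j + l - 1) =
        (-1) ^ (j - 1) * Nat.fib l + M * Nat.fib (j - 1) := by
      rw [hM, h1, h2, ← h3]; ring
    have h5 : (((Nat.fib j : ℤ) * (Nat.fib (j + l - 1) : ℤ) : ℤ) / M : ℝ) =
        (-1) ^ (j - 1) * (Nat.fib l / M) + (Nat.fib (j - 1) : ℤ) := by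
      rw [h4]; push_cast; field_simp
    rw [h5, abs_cos_pi_mul_add_int]
    rcases neg_one_pow_eq_or ℝ (j - 1) with h | h <;> simp [h]
  rw [hshift]
  set a : ℝ := (Nat.fib j : ℝ) with haa
  set b : ℝ := (Nat.fib l : ℝ) with hbb
  have ha' : 21 ≤ a := by rw [haa]; exact_mod_cast ha
  have hb' : 21 ≤ b := by rw [hbb]; exact_mod_cast hb
  have hab' : a * b ≤ M := by rw [haa, hbb]; exact_mod_cast hab
  -- Since `d ≥ 21`, the angle `π * c / M` is at most `π / 21 < 1`. The two exponents then total at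
  -- most `2π² ≤ 20`.
  have key (c d : ℝ) (hc : 21 ≤ c) (hd : 21 ≤ d) (hcd : c * d ≤ M) :
      Real.exp (-(Real.pi * (c / M)) ^ 2) ≤ |Real.cos (Real.pi * (c / M))| := by
    refine (exp_neg_sq_le_cos ?_).trans (le_abs_self _)
    rw [abs_of_nonneg (by positivity), mul_div_assoc', div_le_one hM0]
    nlinarith [Real.pi_le_four]
  have k1 := key a b ha' hb' hab'
  have k2 := key b a hb' ha' (by linarith)
  simp only [Int.cast_natCast]
  rw [← haa, ← hbb]
  calc Real.exp (-20) ≤ Real.exp (-(Real.pi * (a / M)) ^ 2) ^ Nat.fib l ^ 2 *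
        Real.exp (-(Real.pi * (b / M)) ^ 2) ^ Nat.fib j ^ 2 := by
        rw [← Real.exp_nat_mul, ← Real.exp_nat_mul, ← Real.exp_add, Real.exp_le_exp]
        push_cast
        rw [← haa, ← hbb]
        have e : b ^ 2 * -(Real.pi * (a / M)) ^ 2 + a ^ 2 * -(Real.pi * (b / M)) ^ 2 =
            -(2 * Real.pi ^ 2 * (a * b / M) ^ 2) := by ring
        rw [e]
        have h1 : (a * b / M) ^ 2 ≤ 1 :=
          pow_le_one₀ (by positivity) ((div_le_one hM0).2 hab')
        have h2 : Real.pi ^ 2 ≤ 10 := by nlinarith [Real.pi_lt_d2, Real.pi_pos]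
        have h3 : Real.pi ^ 2 * (a * b / M) ^ 2 ≤ 10 * 1 := by gcongr
        linarith
    _ ≤ _ := by gcongr

/-- The character of frequency `fib j` is invisible at the levels `i` well below `j`. -/
theorem norm_integral_fibLaw_le_exp {i k j l : ℕ} (hi : 1 ≤ i) (hk : 1 ≤ k) (hij : i + 8 ≤ j)
    (hl : 8 ≤ l) (hil : i + k = j + l) (p : ℕ) {M : ℕ} [NeZero M] (hM : M = Nat.fib (i + k)) :
    ‖∫ z : ℤ, ZMod.stdAddChar (((Nat.fib j : ℤ) : ZMod M) * (z : ZMod M)) ∂(fibLaw i k p)‖ ≤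
      Real.exp (-22) := by
  rw [fibLaw, norm_integral_stdAddChar_coarseLaw]
  have hM0 : (0 : ℝ) < M := by exact_mod_cast NeZero.pos M
  have hb := Nat.le_fib_of_eight_le hl
  have hab : Nat.fib j * Nat.fib l ≤ M := by
    rw [hM, hil]; exact Nat.fib_mul_fib_le_fib_add (by omega) (by omega)
  have hM3 : M ≤ 3 * (Nat.fib i * Nat.fib k) := hM ▸ Nat.fib_add_le_three_mul hi hk
  have hgrow : 21 * Nat.fib i ≤ Nat.fib j := by
    have h1 := Nat.fib_mul_fib_le_fib_add (j := 8) (l := i) (by norm_num) hi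
    have h2 : Nat.fib 8 = 21 := rfl
    rw [h2, add_comm] at h1
    exact h1.trans (Nat.fib_mono hij)
  have hhalf : |((Nat.fib j : ℤ) : ℝ) / M| ≤ 1 / 2 := by
    rw [Int.cast_natCast, abs_of_nonneg (by positivity), div_le_iff₀ hM0]
    have : 2 * Nat.fib j ≤ M := by nlinarith
    have : 2 * (Nat.fib j : ℝ) ≤ M := by exact_mod_cast this
    linarith
  calc _ ≤ |Real.cos (Real.pi * ((Nat.fib j : ℤ) / M))| ^ Nat.fib k ^ 2 * 1 := by
        gcongr
        exact pow_le_one₀ (abs_nonneg _) (Real.abs_cos_le_one _)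
    _ ≤ Real.exp (-(2 * (((Nat.fib j : ℤ) : ℝ) / M) ^ 2)) ^ Nat.fib k ^ 2 := by
        rw [mul_one]; gcongr; exact abs_cos_pi_mul_le_exp hhalf
    _ ≤ Real.exp (-22) := by
        rw [← Real.exp_nat_mul, Real.exp_le_exp]
        push_cast
        -- Here `7 = 21 / 3`: an index gap of 8 gives `fib j ≥ 21 * fib i`, while `M ≤ 3 * fib i *
        -- fib k`. The exponent is then at most `-98`.
        have h1 : (7 : ℝ) ≤ Nat.fib k * Nat.fib j / M := by
          rw [le_div_iff₀ hM0]
          have : 7 * M ≤ Nat.fib k * Nat.fib j := by nlinarith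
          exact_mod_cast this
        have h2 : (7 : ℝ) ^ 2 ≤ (Nat.fib k * Nat.fib j / M) ^ 2 := by gcongr
        have h3 : (Nat.fib k : ℝ) ^ 2 * -(2 * ((Nat.fib j : ℝ) / M) ^ 2) =
            -(2 * (Nat.fib k * Nat.fib j / M) ^ 2) := by ring
        rw [h3]
        linarith

/-- The number of summands of `fibLaw j l` is bounded independently of the level. -/
theorem fib_sq_add_fib_sq_le {j l M : ℕ} (hM : M = Nat.fib (j + l)) :
    Nat.fib l ^ 2 + Nat.fib j ^ 2 ≤ 2 * M ^ 2 := by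
  have hl : Nat.fib l ≤ M := hM ▸ Nat.fib_mono (by omega)
  have hj : Nat.fib j ≤ M := hM ▸ Nat.fib_mono (by omega)
  have : Nat.fib l ^ 2 + Nat.fib j ^ 2 ≤ M ^ 2 + M ^ 2 := by gcongr
  linarith

/-- From `fib n ≤ 2 ^ n`, the inner logarithm is at most `8 * (T + 1)`, which for `T ≥ 12` is below
`(T * (9 / 10)) ^ 2`; the square accounts for the 2 in the constant. -/
theorem log_log_fib_le {T : ℕ} (hT : 12 ≤ T) {C : ℝ} (hC : 1 < C) {m : ℕ}
    (h : (T : ℝ) * (9 / 10) ≤ C ^ m) :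
    1 / (2 * Real.log C) * Real.log (Real.log (Nat.fib (8 * (T + 1)) : ℝ)) ≤ m := by
  have hT' : (12 : ℝ) ≤ T := by exact_mod_cast hT
  have hlogC : 0 < Real.log C := Real.log_pos hC
  have hfib2 : (21 : ℝ) ≤ Nat.fib (8 * (T + 1)) := by
    exact_mod_cast Nat.le_fib_of_eight_le (by omega)
  have hfib : (Nat.fib (8 * (T + 1)) : ℝ) ≤ 2 ^ (8 * (T + 1)) := by
    have hpow (n : ℕ) : Nat.fib n ≤ 2 ^ n ∧ Nat.fib (n + 1) ≤ 2 ^ (n + 1) := by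
      induction n with
      | zero => simp
      | succ n ih =>
        refine ⟨ih.2, ?_⟩
        rw [Nat.fib_add_two, pow_succ]
        have := Nat.pow_le_pow_right (n := 2) (by norm_num) (Nat.le_succ n)
        have := ih.1
        have := ih.2
        simp only [Nat.succ_eq_add_one] at *
        omega
    exact_mod_cast (hpow _).1
  have h1 : Real.log (Nat.fib (8 * (T + 1)) : ℝ) ≤ 8 * (T + 1) := by
    refine (Real.log_le_log (by linarith) hfib).trans ?_
    rw [Real.log_pow]
    push_cast
    exact mul_le_of_le_one_right (by positivity) (by linarith [Real.log_two_lt_d9])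
  have h0 : 0 < Real.log (Nat.fib (8 * (T + 1)) : ℝ) := Real.log_pos (by linarith)
  have h2 : Real.log (Real.log (Nat.fib (8 * (T + 1)) : ℝ)) ≤ 2 * (m * Real.log C) := by
    calc _ ≤ Real.log (8 * (T + 1)) := Real.log_le_log h0 h1
      _ ≤ Real.log (((T : ℝ) * (9 / 10)) ^ 2) :=
          Real.log_le_log (by positivity) (by nlinarith)
      _ ≤ Real.log ((C ^ m) ^ 2) := Real.log_le_log (by positivity) (by gcongr)
      _ = 2 * (m * Real.log C) := by rw [Real.log_pow, Real.log_pow]; norm_num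
  rw [one_div, inv_mul_le_iff₀ (by positivity)]
  linarith

/-! ### The lower bound -/

theorem theorem5 :
    ∃ ε₀ : ℝ, 0 < ε₀ ∧ ∃ c : ℝ, 0 < c ∧
      ∃ Q : Set (ℤ × ℤ × ℤ × ℤ), Q.Infinite ∧
        ∀ a₁ a₂ a₃ a₄ : ℤ, (a₁, a₂, a₃, a₄) ∈ Q →
          0 ≤ a₁ ∧ a₁ < a₂ ∧ a₂ < a₃ ∧ a₃ < a₄ ∧
          ∃ N₀ : ℕ, ∀ N : ℕ, N₀ ≤ N → ∀ ε : ℝ, 0 < ε → ε ≤ ε₀ →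
            ∀ (m : ℕ) (L : Learner m), L.LearnsSums {a₁, a₂, a₃, a₄} N ε →
              c * Real.log (Real.log (a₄ : ℝ)) ≤ (m : ℝ) := by
  have hmass := one_le_latticeMass
  have hlog : 0 < Real.log (2 * latticeMass) := Real.log_pos (by linarith)
  refine ⟨Real.exp (-21) / 8, by positivity, 1 / (2 * Real.log (2 * latticeMass)), by positivity,
    Set.range fun t : ℕ => (0, 1, (Nat.fib (8 * (t + 12 + 1) - 1) : ℤ),
      (Nat.fib (8 * (t + 12 + 1)) : ℤ)), Set.infinite_range_of_injective fun s t h => ?_, ?_⟩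
  · simp only [Prod.mk.injEq, Nat.cast_inj, true_and] at h
    have h' := Nat.fib_strictMonoOn.injOn (x₁ := 8 * (s + 12 + 1)) (x₂ := 8 * (t + 12 + 1))
      (Set.mem_Ici.2 (by omega)) (Set.mem_Ici.2 (by omega)) h.2
    omega
  rintro a₁ a₂ a₃ a₄ ⟨t₀, ht₀⟩
  obtain ⟨T, hT, hTt⟩ : ∃ T, 12 ≤ T ∧ t₀ + 12 = T := ⟨_, by omega, rfl⟩
  simp only [Prod.mk.injEq, hTt] at ht₀
  obtain ⟨rfl, rfl, rfl, rfl⟩ := ht₀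
  have hv1 : 21 ≤ Nat.fib (8 * (T + 1) - 1) := Nat.le_fib_of_eight_le (by omega)
  have hvM : Nat.fib (8 * (T + 1) - 1) < Nat.fib (8 * (T + 1)) := by
    have := Nat.fib_lt_fib_succ (n := 8 * (T + 1) - 1) (by omega)
    rwa [Nat.sub_add_cancel (by omega)] at this
  refine ⟨le_rfl, one_pos, by exact_mod_cast (by omega : 1 < Nat.fib (8 * (T + 1) - 1)),
    by exact_mod_cast hvM, ?_⟩
  obtain ⟨M, hM⟩ : ∃ M, M = Nat.fib (8 * (T + 1)) := ⟨_, rfl⟩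
  have hMpos : 0 < M := by omega
  have : NeZero M := ⟨hMpos.ne'⟩
  set W : ℕ := M ^ 2 + M with hW
  -- With `n + 1 = (2 * W) ^ 2`, shifts by up to `W` stay within a standard deviation, and the
  -- envelope has mass at most 2.
  set n : ℕ := (2 * W) ^ 2 - 1 with hn
  have hWpos : 2 ≤ W := by nlinarith
  have hn1 : n + 1 = (2 * W) ^ 2 := by
    have : 0 < (2 * W) ^ 2 := by positivity
    omega
  have hn0 : n ≠ 0 := by nlinarith
  refine ⟨2 * M ^ 2 + n, fun N hN ε hε hε₀ m L hL => ?_⟩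
  have hlev (t : Fin T) : 8 * (t + 1) + 8 * (T - t) = 8 * (T + 1) := by omega
  -- Padding up to exactly `N` summands; the lower bound on `N` prevents truncation of the
  -- subtraction.
  set p : Fin T → ℕ := fun t =>
    N - (Nat.fib (8 * (T - t)) ^ 2 + Nat.fib (8 * (t + 1)) ^ 2 + n) with hp
  set μ : Fin T → Measure ℤ := fun t => fibLaw (8 * (t + 1)) (8 * (T - t)) (p t) with hμ
  have hMt (t : Fin T) : M = Nat.fib (8 * (t + 1) + 8 * (T - t)) := by rw [hlev, hM]
  set S : Fin T → ProbabilityMeasure ℤ := fun t => ⟨addFairSteps M n (μ t), inferInstance⟩ with hS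
  have hsum (t : Fin T) :
      IsSupportSum {0, 1, (Nat.fib (8 * (T + 1) - 1) : ℤ), (Nat.fib (8 * (T + 1)) : ℤ)} N
        (S t) := by
    have h := isSupportSum_addFairSteps_coarseLaw M (Nat.fib (8 * (T + 1) - 1)) (n := n)
      (n₁ := Nat.fib (8 * (T - t)) ^ 2) (n₂ := Nat.fib (8 * (t + 1)) ^ 2) (p t) hn0
      (pow_ne_zero _ (Nat.fib_pos.2 (by omega)).ne') (pow_ne_zero _ (Nat.fib_pos.2 (by omega)).ne')
    have hb := fib_sq_add_fib_sq_le (hMt t)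
    have e : Nat.fib (8 * (T - t)) ^ 2 + Nat.fib (8 * (t + 1)) ^ 2 + n + p t = N := by
      simp only [hp]; omega
    rw [e] at h
    rw [← hM]
    have hS' : S t = ⟨addFairSteps M n (coarseLaw (Nat.fib (8 * (T + 1) - 1))
        (Nat.fib (8 * (T - t)) ^ 2) (Nat.fib (8 * (t + 1)) ^ 2) (p t)), inferInstance⟩ := by
      apply Subtype.ext
      simp only [hS, hμ, fibLaw, hlev]
    rw [hS']
    exact h
  have hdom (t : Fin T) (z : ℤ) : (S t : Measure ℤ) {z} ≤
      ENNReal.ofReal (latticeMass / M * binomialEnvelope n W (z / M)) := by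
    have h := addFairSteps_real_singleton_le n W (μ t) (fibLaw_support (p t) (hMt t))
      (fibLaw_residue_le (by omega) (by omega) (p t) (hMt t)) z
    rw [← ENNReal.ofReal_toReal (measure_ne_top (S t : Measure ℤ) {z})]
    exact ENNReal.ofReal_le_ofReal h
  have hsep_lt (s t : Fin T) (hst : s < t) : 2 * ε < tvDist (S s) (S t) := by
    set f : ℤ → ℂ := fun z =>
      ZMod.stdAddChar (((Nat.fib (8 * (t + 1)) : ℤ) : ZMod M) * (z : ZMod M)) with hf
    have h := norm_integral_sub_le_tvDist (S s) (S t) f fun z => (norm_stdAddChar _).le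
    have hst' : (s : ℕ) < t := hst
    have hs : ‖∫ z, f z ∂(S s : Measure ℤ)‖ ≤ Real.exp (-22) := by
      have h1 := integral_stdAddChar_addFairSteps_self n (μ s)
        ((Nat.fib (8 * (t + 1)) : ℤ) : ZMod M)
      have h2 := norm_integral_fibLaw_le_exp (i := 8 * (s + 1)) (k := 8 * (T - s))
        (j := 8 * (t + 1)) (l := 8 * (T - t)) (by omega) (by omega) (by omega) (by omega)
        (by rw [hlev, hlev]) (p s) (hMt s)
      rw [← h1] at h2
      exact h2
    have ht : Real.exp (-20) ≤ ‖∫ z, f z ∂(S t : Measure ℤ)‖ := by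
      have h1 := integral_stdAddChar_addFairSteps_self n (μ t)
        ((Nat.fib (8 * (t + 1)) : ℤ) : ZMod M)
      have h2 := exp_le_norm_integral_fibLaw_self (j := 8 * (t + 1)) (l := 8 * (T - t))
        (by omega) (by omega) (p t) (hMt t)
      rw [← h1] at h2
      exact h2
    have h3 := norm_sub_norm_le (∫ z, f z ∂(S t : Measure ℤ)) (∫ z, f z ∂(S s : Measure ℤ))
    rw [norm_sub_rev] at h3
    -- The coefficient gap is thus at least `exp (-21)`, so the distance is at least `exp (-21) /
    -- 2`, while `2 * ε ≤ exp (-21) / 4`.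
    have h4 : 2 * Real.exp (-21) ≤ Real.exp (-20) := by
      have : Real.exp (-20) = Real.exp 1 * Real.exp (-21) := by rw [← Real.exp_add]; norm_num
      rw [this]
      gcongr
      linarith [Real.add_one_le_exp 1]
    have h5 : Real.exp (-22) ≤ Real.exp (-21) := Real.exp_le_exp.2 (by norm_num)
    have h6 := Real.exp_pos (-21)
    linarith
  have hcomm (P P' : ProbabilityMeasure ℤ) : tvDist P P' = tvDist P' P := by
    simp only [tvDist, abs_sub_comm]
  have hsep (s t : Fin T) (hst : s ≠ t) : 2 * ε < tvDist (S s) (S t) := by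
    rcases lt_or_gt_of_ne hst with h | h
    · exact hsep_lt s t h
    · rw [hcomm]; exact hsep_lt t s h
  have hpack := L.card_le_pow S ε _ (ENNReal.ofReal (2 * latticeMass)) ENNReal.ofReal_ne_top
    (tsum_ofReal_binomialEnvelope_ediv_le (by omega) hn1 le_rfl (by linarith)) hdom hsep
    fun t => hL (S t) (hsum t)
  have hreal : (T : ℝ) * (9 / 10) ≤ (2 * latticeMass) ^ m := by
    have := ENNReal.toReal_mono (by finiteness) hpack
    rw [ENNReal.toReal_pow, ENNReal.toReal_ofReal (by linarith)] at this
    simpa using this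
  rw [Int.cast_natCast]
  exact log_log_fib_le hT (by linarith) hreal
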